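/- Let $1\le r<N$ and $L\ge 1$ be integers, let $p_1,\dots,p_L\ge 0$ with $\sum_i p_i=1$, and let $\Sigma_1,\dots,\Sigma_L\in\mathbb{R}^{N\times N}$ be random positive semidefinite matrices whose images $\mathcal{R}_i=\mathrm{Im}(\Sigma_i)$ have dimension $r$ and are independent random points of the Grassmann manifold of $r$-dimensional subspaces of $\mathbb{R}^N$, each having a probability density with respect to the rotation-invariant probability measure on that manifold (the law of the span of $r$ independent standard Gaussian vectors). Write $\mathcal{N}_i=\mathrm{Null}(\Sigma_i)$. Given $\Sigma_1,\dots,\Sigma_L$, a matrix $\Phi\in\mathbb{R}^{M\times N}$ and $\sigma^2>0$, a class $C\in\{1,\dots,L\}$ is drawn with $\mathbb{P}[C=i]=p_i$, the signal $\mathbf{x}$ is $\mathcal{N}(0,\Sigma_i)$ conditionally on $C=i$, and $\mathbf{y}=\Phi\mathbf{x}+\mathbf{n}$ is observed, where $\mathbf{n}\sim\mathcal{N}(0,\sigma^2 I)$ is independent of $(C,\mathbf{x})$. Let $p(\mathbf{y}\mid C=i)$ be the conditional probability density of $\mathbf{y}$, let $\hat C(\mathbf{y})\in\arg\max_i\,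 p(\mathbf{y}\mid C=i)\,p_i$ be a (measurable) maximum a posteriori classifier, with ties broken in any way, and let $$P_e=\mathbb{P}[\hat C\ne C]=\sum_{i=1}^L p_i\,\mathbb{P}[\hat C\neq i\mid C=i].$$ Put $M=\min\{L-1,\,r+1\}$. Then: 1. With probability one over $(\Sigma_1,\dots,\Sigma_L)$, there is a matrix $\Phi\in\mathbb{R}^{M\times N}$ for which $\lim_{\sigma^2\to0}P_e=0$; that is, $M$ is an upper bound on the minimum number of designed measurements for which $\lim_{\sigma^2\to 0}P_e=0$. 2. For each $i$ let the columns of $\mathbf{N}_i\in\mathbb{R}^{N\times(N-r)}$ form a (possibly random) basis of $\mathcal{N}_i$, depending measurably on the underlying randomness and such that the pairs $(\mathcal{R}_i,\mathbf{N}_i)$, $i=1,\dots,L$, are independent (for instance, each $\mathbf{N}_i$ is a measurable function of $\mathcal{N}_i$ alone). Then, with probability one, for every permutation $\pi$ of $\{1,\dots,L\}$ and every matrix $\Phi\in\mathbb{R}^{M\times N}$ whose $M$ rows are obtained by picking one row from each of $\mathbf{N}_{\pi(1)}^T,\dots,\mathbf{N}_{\pi(M)}^T$, one has $\lim_{\sigma^2\to0}P_e=0$.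 -/

import Mathlib

open MeasureTheory ProbabilityTheory Filter Topology
open scoped ENNReal

noncomputable section

namespace SubspaceClassification

/-- `ℝⁿ` with its Euclidean structure. -/
abbrev Vec (n : ℕ) : Type := EuclideanSpace ℝ (Fin n)

/-! ### The Grassmann manifold and its invariant measure -/

/-- The set of `r`-dimensional linear subspaces of `ℝᴺ`. -/
def Grassmannian (N r : ℕ) : Type :=
  {W : Submodule ℝ (Vec N) // Module.finrank ℝ W = r}

/-- The orthogonal projection onto a point of the Grassmann manifold. -/
def Grassmannian.proj {N r : ℕ} (W : Grassmannian N r) : Vec N →L[ℝ] Vec N :=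
  W.1.starProjection

/-- The usual topology of the Grassmann manifold: that of the metric `‖P_V - P_W‖`, where `P_V` is
the orthogonal projection onto `V`. -/
instance (N r : ℕ) : TopologicalSpace (Grassmannian N r) :=
  TopologicalSpace.induced Grassmannian.proj inferInstance

instance (N r : ℕ) : MeasurableSpace (Grassmannian N r) := borel _

instance (N r : ℕ) : BorelSpace (Grassmannian N r) := ⟨rfl⟩

/-- The linearly independent `r`-tuples of vectors of `ℝᴺ`. -/
def Frame (N r : ℕ) : Type := {v : Fin r → Vec N // LinearIndependent ℝ v}

instance (N r : ℕ) : TopologicalSpace (Frame N r) :=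
  inferInstanceAs (TopologicalSpace {v : Fin r → Vec N // LinearIndependent ℝ v})

instance (N r : ℕ) : MeasurableSpace (Frame N r) :=
  inferInstanceAs (MeasurableSpace {v : Fin r → Vec N // LinearIndependent ℝ v})

instance (N r : ℕ) : BorelSpace (Frame N r) :=
  inferInstanceAs (BorelSpace {v : Fin r → Vec N // LinearIndependent ℝ v})

/-- The subspace spanned by a frame. -/
def Frame.span {N r : ℕ} (v : Frame N r) : Grassmannian N r :=
  ⟨Submodule.span ℝ (Set.range v.1), by
    simpa using finrank_span_eq_card v.2⟩

/-- The rotation-invariant (uniform) probability measure on the Grassmann manifold: the law of the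
span of `r` independent standard Gaussian vectors of `ℝᴺ`, for `r ≤ N`
(such vectors are linearly independent almost surely). -/
def uniformGrassmannian (N r : ℕ) : Measure (Grassmannian N r) :=
  (Measure.comap (Subtype.val : Frame N r → Fin r → Vec N)
    (Measure.pi fun _ : Fin r => stdGaussian (Vec N))).map Frame.span

/-- The projection onto the span of a frame, in terms of the inverse Gram matrix. -/
theorem Frame.proj_span_apply {N r : ℕ} (v : Frame N r) (x : Vec N) :
    v.span.proj x =
      ∑ i, ((Matrix.gram ℝ v.1)⁻¹.mulVec (fun j => inner ℝ (v.1 j) x)) i • v.1 i := by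
  have hdet : IsUnit (Matrix.gram ℝ v.1).det := by
    have := (Matrix.posDef_gram_of_linearIndependent (𝕜 := ℝ) v.2).det_pos
    exact (ne_of_gt this).isUnit
  refine Submodule.eq_starProjection_of_mem_of_inner_eq_zero (K := v.span.1) ?_ ?_
  · exact Submodule.sum_mem _ fun i _ =>
      Submodule.smul_mem _ _ (Submodule.subset_span ⟨i, rfl⟩)
  · intro w hw
    refine Submodule.span_induction (p := fun w _ => inner ℝ (x - _) w = 0) ?_ ?_ ?_ ?_ hw
    · rintro _ ⟨j, rfl⟩
      rw [real_inner_comm, inner_sub_right, inner_sum]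
      simp only [real_inner_smul_right]
      have h : (Matrix.gram ℝ v.1).mulVec
          ((Matrix.gram ℝ v.1)⁻¹.mulVec (fun j => inner ℝ (v.1 j) x)) j = inner ℝ (v.1 j) x := by
        rw [Matrix.mulVec_mulVec, Matrix.mul_nonsing_inv _ hdet, Matrix.one_mulVec]
      rw [← h]
      simp only [Matrix.mulVec, dotProduct, Matrix.gram_apply]
      rw [sub_eq_zero]
      exact Finset.sum_congr rfl fun i _ => mul_comm _ _
    · simp
    · intro a b _ _ ha hb
      rw [inner_add_right, ha, hb, add_zero]
    · intro c a _ ha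
      rw [inner_smul_right, ha, mul_zero]

/-- The span depends continuously on the frame. -/
theorem Frame.continuous_span {N r : ℕ} :
    Continuous (Frame.span : Frame N r → Grassmannian N r) := by
  rw [continuous_induced_rng, continuous_clm_apply]
  intro x
  have hv : Continuous (fun v : Frame N r => v.1) := continuous_subtype_val
  have hvi : ∀ i, Continuous (fun v : Frame N r => v.1 i) := fun i =>
    (continuous_apply i).comp hv
  have hg : Continuous (fun v : Frame N r => Matrix.gram ℝ v.1) :=
    continuous_matrix fun i j => by
      simpa [Matrix.gram_apply] using (hvi i).inner (hvi j)
  have hgi : Continuous (fun v : Frame N r => (Matrix.gram ℝ v.1)⁻¹) := by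
    simp only [Matrix.inv_def, Ring.inverse_eq_inv']
    refine Continuous.smul (hg.matrix_det.inv₀ fun v => ?_) hg.matrix_adjugate
    exact (Matrix.posDef_gram_of_linearIndependent (𝕜 := ℝ) v.2).det_pos.ne'
  have h : (fun v : Frame N r => v.span.proj x) = fun v =>
      ∑ i, ((Matrix.gram ℝ v.1)⁻¹.mulVec (fun j => inner ℝ (v.1 j) x)) i • v.1 i :=
    funext fun v => v.proj_span_apply x
  change Continuous (fun v : Frame N r => v.span.proj x)
  rw [h]
  refine continuous_finsetSum _ fun i _ => ?_
  have hc : Continuous (fun v : Frame N r =>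
      (Matrix.gram ℝ v.1)⁻¹.mulVec (fun j => inner ℝ (v.1 j) x) i) :=
    (continuous_apply i).comp
      (hgi.matrix_mulVec (continuous_pi fun j => (hvi j).inner continuous_const))
  exact hc.smul (hvi i)

/-- The frames form a measurable set of tuples. -/
theorem Frame.measurableEmbedding_val {N r : ℕ} :
    MeasurableEmbedding (Subtype.val : Frame N r → Fin r → Vec N) :=
  MeasurableEmbedding.subtype_coe (isOpen_setOfPred_linearIndependent (𝕜 := ℝ)).measurableSet

/-- Hence `uniformGrassmannian` is the push-forward along a measurable map. -/
theorem Frame.measurable_span {N r : ℕ} :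
    Measurable (Frame.span : Frame N r → Grassmannian N r) :=
  Frame.continuous_span.measurable

/-! ### The measurement model and the MAP classifier -/

/-- The image of a matrix, as a subspace of `ℝᴺ`. -/
abbrev image {N : ℕ} (S : Matrix (Fin N) (Fin N) ℝ) : Submodule ℝ (Vec N) :=
  LinearMap.range (Matrix.toEuclideanLin S)

/-- The null space of a matrix, as a subspace of `ℝᴺ`. -/
abbrev nullSpace {N : ℕ} (S : Matrix (Fin N) (Fin N) ℝ) : Submodule ℝ (Vec N) :=
  LinearMap.ker (Matrix.toEuclideanLin S)

variable {L M N : ℕ}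

/-- The law of the measurement `y = Φ x + n` when `x ∼ 𝒩(0, S)` and `n ∼ 𝒩(0, s I)` are
independent; `s` is the noise variance `σ²`. -/
def measurementLaw (Φ : Matrix (Fin M) (Fin N) ℝ) (s : ℝ) (S : Matrix (Fin N) (Fin N) ℝ) :
    Measure (Vec M) :=
  ((multivariateGaussian (0 : Vec N) S).prod
    (multivariateGaussian (0 : Vec M) (s • (1 : Matrix (Fin M) (Fin M) ℝ)))).map
      fun z => Matrix.toEuclideanLin Φ z.1 + z.2

/-- The probability density function of the measurement `y`, with respect to Lebesgue measure. -/
def measurementPDF (Φ : Matrix (Fin M) (Fin N) ℝ) (s : ℝ) (S : Matrix (Fin N) (Fin N) ℝ) :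
    Vec M → ℝ≥0∞ :=
  (measurementLaw Φ s S).rnDeriv volume

/-- `c` is a maximum a posteriori classifier for the classes `𝒩(0, S i)` with prior probabilities
`p i`: it picks, for (almost) every `y`, some `i` that maximizes `p(y | C = i) p i`. -/
def IsMAP (p : Fin L → ℝ) (S : Fin L → Matrix (Fin N) (Fin N) ℝ)
    (Φ : Matrix (Fin M) (Fin N) ℝ) (s : ℝ) (c : Vec M → Fin L) : Prop :=
  Measurable c ∧ ∀ᵐ y, ∀ j,
    measurementPDF Φ s (S j) y * ENNReal.ofReal (p j) ≤
      measurementPDF Φ s (S (c y)) y * ENNReal.ofReal (p (c y))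

/-- MAP classifiers exist. -/
theorem exists_isMAP [NeZero L] (p : Fin L → ℝ) (S : Fin L → Matrix (Fin N) (Fin N) ℝ)
    (Φ : Matrix (Fin M) (Fin N) ℝ) (s : ℝ) : ∃ c, IsMAP p S Φ s c := by
  classical
  set g : Fin L → Vec M → ℝ≥0∞ := fun i y =>
    measurementPDF Φ s (S i) y * ENNReal.ofReal (p i) with hgdef
  have hg : ∀ i, Measurable (g i) := fun i =>
    (Measure.measurable_rnDeriv _ _).mul_const _
  let A : Vec M → Finset (Fin L) := fun y => Finset.univ.filter fun i => ∀ j, g j y ≤ g i y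
  have hA : ∀ y, (A y).Nonempty := fun y => by
    obtain ⟨i, hi⟩ := Finite.exists_max (fun i => g i y)
    exact ⟨i, by simpa [A] using hi⟩
  have hAm : ∀ i, MeasurableSet {y | i ∈ A y} := fun i => by
    simp only [A, Finset.mem_filter, Finset.mem_univ, true_and, Set.ofPred_forall]
    exact MeasurableSet.iInter fun j => measurableSet_le (hg j) (hg i)
  refine ⟨fun y => (A y).min' (hA y), measurable_to_countable' fun i => ?_,
    Eventually.of_forall fun y j => ?_⟩
  · have : (fun y => (A y).min' (hA y)) ⁻¹' {i} =
        {y | i ∈ A y} ∩ ⋂ j, ⋂ (_ : j < i), {y | j ∈ A y}ᶜ := by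
      ext y
      simp only [Set.mem_preimage, Set.mem_singleton_iff, Set.mem_inter_iff, Set.mem_ofPred_eq,
        Set.mem_iInter, Set.mem_compl_iff]
      constructor
      · rintro rfl
        exact ⟨Finset.min'_mem _ _, fun j hj hjA => absurd (Finset.min'_le _ _ hjA) (not_le.2 hj)⟩
      · rintro ⟨h1, h2⟩
        refine le_antisymm (Finset.min'_le _ _ h1) ?_
        by_contra h
        exact h2 _ (not_le.1 h) (Finset.min'_mem _ _)
    rw [this]
    exact (hAm i).inter (MeasurableSet.iInter fun j => MeasurableSet.iInter fun _ => (hAm j).compl)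
  · have := Finset.min'_mem (A y) (hA y)
    simp only [A, Finset.mem_filter, Finset.mem_univ, true_and] at this
    exact this j

/-- The misclassification probability `P[c(y) ≠ C] = ∑ i, p i * P[c(y) ≠ i | C = i]`. -/
def misclassificationProb (p : Fin L → ℝ) (S : Fin L → Matrix (Fin N) (Fin N) ℝ)
    (Φ : Matrix (Fin M) (Fin N) ℝ) (s : ℝ) (c : Vec M → Fin L) : ℝ :=
  ∑ i, p i * (measurementLaw Φ s (S i)).real {y | c y ≠ i}

/-- The misclassification probability of MAP classification tends to `0` as `σ² = s` tends to `0`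
from above, however ties are broken in the MAP classifier. -/
def LowNoisePhaseTransition (p : Fin L → ℝ) (S : Fin L → Matrix (Fin N) (Fin N) ℝ)
    (Φ : Matrix (Fin M) (Fin N) ℝ) : Prop :=
  ∀ c : ℝ → Vec M → Fin L, (∀ s, 0 < s → IsMAP p S Φ s (c s)) →
    Tendsto (fun s => misclassificationProb p S Φ s (c s)) (𝓝[>] 0) (𝓝 0)

/-- The matrix whose `m`-th row is the `k m`-th vector of the basis `B (π m)`, for the first
`M ≤ L` values of the permutation `π`. -/
def oneVsAllMatrix {d : ℕ} (hM : M ≤ L) (B : Fin L → Fin d → Vec N) (π : Equiv.Perm (Fin L))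
    (k : Fin M → Fin d) : Matrix (Fin M) (Fin N) ℝ :=
  Matrix.of fun m j => B (π (Fin.castLE hM m)) (k m) j

end SubspaceClassification

end

/-!
A vector `w = Φᵀ c` of the row space of `Φ` turns `y` into the scalar `⟪c, y⟫`, a centred Gaussian
of variance `⟪w, S w⟫ + σ² ‖c‖²` under the class with covariance `S`. If `w` is orthogonal to the
image of one class but not to that of another, one of the two variances tends to `0` with `σ²` while
the other does not, so comparing `|⟪c, y⟫|` with a threshold separates the two classes in the limit.
MAP classification does at least as well as these pairwise tests, so it suffices to find such a `w`
for each pair of classes. If one of the rows is taken from the null space of one of the two classes,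
that row almost surely will do. Otherwise `L ≥ M + 2`, hence `M ≥ r + 1`, and `r + 1` of the rows
have a nontrivial combination orthogonal to the `r`-dimensional image of the first class; it is
almost surely not orthogonal to the second image, which is independent of these rows and of the
first image.
-/

namespace SubspaceClassification

/-! ### Absolute continuity of Gaussian laws -/

theorem pi_absolutelyContinuous {n : ℕ} {α : Fin n → Type*} [∀ i, MeasurableSpace (α i)]
    {μ ν : ∀ i, Measure (α i)} [∀ i, SigmaFinite (μ i)] [∀ i, SigmaFinite (ν i)]
    (h : ∀ i, μ i ≪ ν i) : Measure.pi μ ≪ Measure.pi ν := by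
  induction n with
  | zero => rw [Measure.pi_of_empty, Measure.pi_of_empty]
  | succ n ih =>
    have hμ := (measurePreserving_piFinSuccAbove μ 0).symm
    have hν := (measurePreserving_piFinSuccAbove ν 0).symm
    rw [← hμ.map_eq, ← hν.map_eq]
    exact ((h 0).prod (ih fun i => h _)).map hμ.measurable

theorem stdGaussian_absolutelyContinuous (E : Type*) [NormedAddCommGroup E]
    [InnerProductSpace ℝ E] [FiniteDimensional ℝ E] [MeasurableSpace E] [BorelSpace E] :
    stdGaussian E ≪ volume := by
  have hpi := pi_absolutelyContinuous fun _ : Fin (Module.finrank ℝ E) =>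
    gaussianReal_absolutelyContinuous 0 one_ne_zero
  have hVec := (PiLp.volume_preserving_toLp (Fin (Module.finrank ℝ E)))
  have hE := (stdOrthonormalBasis ℝ E).measurePreserving_repr_symm
  rw [← stdGaussian_map (stdOrthonormalBasis ℝ E).repr.symm, ← map_pi_eq_stdGaussian,
    ← hE.map_eq, ← hVec.map_eq]
  exact (hpi.map hVec.measurable).map hE.measurable

open scoped MatrixOrder in
theorem multivariateGaussian_absolutelyContinuous {ι : Type*} [Fintype ι] [DecidableEq ι]
    (m : EuclideanSpace ℝ ι) {S : Matrix ι ι ℝ} (hS : S.PosDef) :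
    multivariateGaussian m S ≪ volume := by
  set A := Matrix.toEuclideanCLM (𝕜 := ℝ) (CFC.sqrt S)
  have hA : LinearMap.det (A : EuclideanSpace ℝ ι →ₗ[ℝ] EuclideanSpace ℝ ι) ≠ 0 := by
    have hsq : CFC.sqrt S * CFC.sqrt S = S := CFC.sqrt_mul_sqrt_self S hS.posSemidef.nonneg
    have hdet : (CFC.sqrt S).det ≠ 0 := fun h =>
      hS.det_pos.ne' (by rw [← hsq, Matrix.det_mul, h, zero_mul])
    rwa [Matrix.coe_toEuclideanCLM_eq_toEuclideanLin, LinearMap.det_toLpLin]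
  have hAm : Measurable A := A.measurable
  have hmap : (multivariateGaussian m S) =
      ((stdGaussian (EuclideanSpace ℝ ι)).map A).map (m + ·) := by
    rw [multivariateGaussian, Measure.map_map (by fun_prop) hAm]
    rfl
  have hvol : (volume : Measure (EuclideanSpace ℝ ι)).map A ≪ volume := by
    have := Measure.map_linearMap_addHaar_eq_smul_addHaar
      (volume : Measure (EuclideanSpace ℝ ι)) hA
    rw [ContinuousLinearMap.coe_coe] at this
    rw [this]
    exact Measure.smul_absolutelyContinuous
  rw [hmap, ← map_add_left_eq_self volume m]
  exact (((stdGaussian_absolutelyContinuous _).map hAm).trans hvol).map (measurable_const_add m)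

variable {L M N r : ℕ}

theorem measurable_toEuclideanLin (Φ : Matrix (Fin M) (Fin N) ℝ) :
    Measurable (Matrix.toEuclideanLin Φ) :=
  (LinearMap.continuous_of_finiteDimensional _).measurable

instance isProbabilityMeasure_measurementLaw (Φ : Matrix (Fin M) (Fin N) ℝ) (s : ℝ)
    (S : Matrix (Fin N) (Fin N) ℝ) : IsProbabilityMeasure (measurementLaw Φ s S) :=
  Measure.isProbabilityMeasure_map (by fun_prop)

theorem measurementLaw_eq_conv (Φ : Matrix (Fin M) (Fin N) ℝ) (s : ℝ)
    (S : Matrix (Fin N) (Fin N) ℝ) :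
    measurementLaw Φ s S =
      ((multivariateGaussian (0 : Vec N) S).map (Matrix.toEuclideanLin Φ)) ∗
        (multivariateGaussian (0 : Vec M) (s • (1 : Matrix (Fin M) (Fin M) ℝ))) := by
  rw [Measure.conv, ← Measure.map_id (μ := multivariateGaussian (0 : Vec M) _),
    Measure.map_prod_map _ _ (measurable_toEuclideanLin Φ) measurable_id,
    Measure.map_map (by fun_prop) (by fun_prop)]
  rfl

theorem measurementLaw_absolutelyContinuous (Φ : Matrix (Fin M) (Fin N) ℝ) {s : ℝ} (hs : 0 < s)
    (S : Matrix (Fin N) (Fin N) ℝ) : measurementLaw Φ s S ≪ volume := by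
  rw [measurementLaw_eq_conv]
  exact Measure.conv_absolutelyContinuous
    (multivariateGaussian_absolutelyContinuous 0 (Matrix.PosDef.one.smul hs))

/-! ### One-dimensional marginals -/

theorem map_inner_multivariateGaussian {ι : Type*} [Fintype ι] [DecidableEq ι]
    (m : EuclideanSpace ℝ ι) {S : Matrix ι ι ℝ} (hS : S.PosSemidef) (w : EuclideanSpace ℝ ι) :
    (multivariateGaussian m S).map (innerSL ℝ w) =
      gaussianReal (inner ℝ w m) (inner ℝ w (Matrix.toEuclideanLin S w)).toNNReal := by
  have hvar : inner ℝ w (Matrix.toEuclideanLin S w) =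
      Var[innerSL ℝ w; multivariateGaussian m S] := by
    change _ = Var[fun x => inner ℝ w x; multivariateGaussian m S]
    rw [← covarianceBilin_self IsGaussian.memLp_two_id, covarianceBilin_multivariateGaussian hS,
      ← Matrix.inner_toEuclideanCLM]
    rfl
  rw [hvar, IsGaussian.map_eq_gaussianReal,
    ContinuousLinearMap.integral_comp_id_comm IsGaussian.integrable_id,
    integral_id_multivariateGaussian, innerSL_apply_apply]

theorem inner_toEuclideanLin_right (Φ : Matrix (Fin M) (Fin N) ℝ) (c : Vec M) (x : Vec N) :
    inner ℝ c (Matrix.toEuclideanLin Φ x) = inner ℝ (Matrix.toEuclideanLin Φ.transpose c) x := by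
  rw [← Matrix.conjTranspose_eq_transpose_of_trivial,
    Matrix.toEuclideanLin_conjTranspose_eq_adjoint, LinearMap.adjoint_inner_left]

theorem map_inner_measurementLaw (Φ : Matrix (Fin M) (Fin N) ℝ) {s : ℝ} (hs : 0 ≤ s)
    {S : Matrix (Fin N) (Fin N) ℝ} (hS : S.PosSemidef) (c : Vec M) {w : Vec N}
    (hw : Matrix.toEuclideanLin Φ.transpose c = w) :
    (measurementLaw Φ s S).map (innerSL ℝ c) =
      gaussianReal 0 ((inner ℝ w (Matrix.toEuclideanLin S w)).toNNReal +
        (s * ‖c‖ ^ 2).toNNReal) := by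
  have hsignal : ((multivariateGaussian (0 : Vec N) S).map (Matrix.toEuclideanLin Φ)).map
      (innerSL ℝ c) = gaussianReal 0 (inner ℝ w (Matrix.toEuclideanLin S w)).toNNReal := by
    rw [Measure.map_map (by fun_prop) (measurable_toEuclideanLin Φ)]
    have hcomp : innerSL ℝ c ∘ Matrix.toEuclideanLin Φ = innerSL ℝ w := by
      ext x
      simp only [Function.comp_apply, innerSL_apply_apply, inner_toEuclideanLin_right, hw]
    rw [hcomp, map_inner_multivariateGaussian 0 hS, inner_zero_right]
  have hnoise : (multivariateGaussian (0 : Vec M) (s • (1 : Matrix (Fin M) (Fin M) ℝ))).map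
      (innerSL ℝ c) = gaussianReal 0 (s * ‖c‖ ^ 2).toNNReal := by
    rw [map_inner_multivariateGaussian 0 (Matrix.PosSemidef.one.smul hs), inner_zero_right]
    simp [real_inner_smul_right]
  have : IsProbabilityMeasure
      ((multivariateGaussian (0 : Vec N) S).map (Matrix.toEuclideanLin Φ)) :=
    Measure.isProbabilityMeasure_map (measurable_toEuclideanLin Φ).aemeasurable
  rw [measurementLaw_eq_conv, Measure.map_conv_continuousLinearMap, hsignal, hnoise,
    gaussianReal_conv_gaussianReal, add_zero]

/-! ### Consistent tests -/

/-- The two families of laws can be told apart along `l`: a test that rejects `P s` on `A s` and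
`Q s` on the complement has errors of both kinds tending to `0`. -/
def HasConsistentTests {ι α : Type*} [MeasurableSpace α] (l : Filter ι) (P Q : ι → Measure α) :
    Prop :=
  ∃ A : ι → Set α, (∀ s, MeasurableSet (A s)) ∧
    Tendsto (fun s => (P s).real (A s)) l (𝓝 0) ∧ Tendsto (fun s => (Q s).real (A s)ᶜ) l (𝓝 0)

namespace HasConsistentTests

variable {ι α β : Type*} [MeasurableSpace α] [MeasurableSpace β] {l : Filter ι}
  {P Q : ι → Measure α}

theorem symm (h : HasConsistentTests l P Q) : HasConsistentTests l Q P := by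
  obtain ⟨A, hA, hP, hQ⟩ := h
  exact ⟨fun s => (A s)ᶜ, fun s => (hA s).compl, hQ, by simpa only [compl_compl] using hP⟩

theorem of_map {P' Q' : ι → Measure β} {f : α → β} (hf : Measurable f)
    (hP : ∀ᶠ s in l, (P s).map f = P' s) (hQ : ∀ᶠ s in l, (Q s).map f = Q' s)
    (h : HasConsistentTests l P' Q') : HasConsistentTests l P Q := by
  obtain ⟨A, hA, hPA, hQA⟩ := h
  refine ⟨fun s => f ⁻¹' A s, fun s => hf (hA s), hPA.congr' ?_, hQA.congr' ?_⟩
  · filter_upwards [hP] with s hs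
    rw [← hs, map_measureReal_apply hf (hA s)]
  · filter_upwards [hQ] with s hs
    rw [← hs, map_measureReal_apply hf (hA s).compl, Set.preimage_compl]

end HasConsistentTests

theorem gaussianReal_real_abs_sub_gt_le (m : ℝ) (v : NNReal) {ε : ℝ} (hε : 0 < ε) :
    (gaussianReal m v).real {x | ε < |x - m|} ≤ v / ε ^ 2 := by
  have h := meas_ge_le_variance_div_sq (memLp_id_gaussianReal' (μ := m) (v := v) 2 (by simp)) hε
  rw [variance_id_gaussianReal] at h
  simp only [id, integral_id_gaussianReal] at h
  exact ENNReal.toReal_le_of_le_ofReal (by positivity)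
    ((measure_mono (Set.ofPred_subset_ofPred.2 fun x hx => hx.le)).trans h)

theorem gaussianReal_le_smul_volume (m : ℝ) {v : NNReal} (hv : v ≠ 0) :
    gaussianReal m v ≤ ENNReal.ofReal (√(2 * Real.pi * v))⁻¹ • volume := by
  have hpdf : ∀ x, gaussianPDF m v x ≤ ENNReal.ofReal (√(2 * Real.pi * v))⁻¹ := fun x => by
    refine ENNReal.ofReal_le_ofReal (mul_le_of_le_one_right (by positivity) ?_)
    exact Real.exp_le_one_iff.2
      (div_nonpos_of_nonpos_of_nonneg (neg_nonpos.2 (sq_nonneg _)) (by positivity))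
  rw [gaussianReal_of_var_ne_zero m hv, ← withDensity_const]
  exact withDensity_mono (Eventually.of_forall hpdf)

theorem gaussianReal_real_abs_le_le (m : ℝ) {v : NNReal} (hv : v ≠ 0) {ε : ℝ} (hε : 0 ≤ ε) :
    (gaussianReal m v).real {x | |x| ≤ ε} ≤ (√(2 * Real.pi * v))⁻¹ * (2 * ε) := by
  refine ENNReal.toReal_le_of_le_ofReal (by positivity)
    ((gaussianReal_le_smul_volume m hv _).trans_eq ?_)
  have hball : {x : ℝ | |x| ≤ ε} = Set.Icc (-ε) ε := by
    ext x
    simp only [Set.mem_ofPred_eq, abs_le, Set.mem_Icc]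
  rw [hball, Measure.smul_apply, Real.volume_Icc, smul_eq_mul, ← ENNReal.ofReal_mul (by positivity)]
  congr 2
  ring

theorem hasConsistentTests_gaussianReal {ι : Type*} {l : Filter ι} {a b : ι → NNReal} {v : NNReal}
    (hv : v ≠ 0) (ha : ∀ᶠ s in l, v ≤ a s) (hb : Tendsto b l (𝓝[>] 0)) :
    HasConsistentTests l (fun s => gaussianReal 0 (a s)) (fun s => gaussianReal 0 (b s)) := by
  have hbpos : ∀ᶠ s in l, 0 < b s := hb.eventually self_mem_nhdsWithin
  have hb0 : Tendsto (fun s => √(b s : ℝ)) l (𝓝 0) := by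
    have hcoe : Tendsto (fun s => (b s : ℝ)) l (𝓝 0) :=
      NNReal.tendsto_coe.2 (tendsto_nhds_of_tendsto_nhdsWithin hb)
    simpa using hcoe.sqrt
  -- the threshold `b ^ (1 / 4)` is large compared with the standard deviation `b ^ (1 / 2)`
  refine ⟨fun s => {x | |x| ≤ √√(b s)},
    fun s => measurableSet_le (by fun_prop) (by fun_prop), ?_, ?_⟩
  · have hlim : Tendsto (fun s => (√(2 * Real.pi * v))⁻¹ * (2 * √√(b s : ℝ))) l (𝓝 0) := by
      simpa using (hb0.sqrt.const_mul 2).const_mul (√(2 * Real.pi * v))⁻¹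
    refine squeeze_zero' (Eventually.of_forall fun s => measureReal_nonneg) ?_ hlim
    filter_upwards [ha] with s hs
    refine (gaussianReal_real_abs_le_le 0 (hs.trans_lt' hv.bot_lt).ne'
      (Real.sqrt_nonneg _)).trans ?_
    gcongr
  · refine squeeze_zero' (Eventually.of_forall fun s => measureReal_nonneg) ?_ hb0
    filter_upwards [hbpos] with s hs
    have hcheb := gaussianReal_real_abs_sub_gt_le 0 (b s) (ε := √√(b s)) (by positivity)
    rw [Real.sq_sqrt (Real.sqrt_nonneg _), Real.div_sqrt] at hcheb
    simpa [Set.compl_ofPred] using hcheb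

theorem inner_toEuclideanLin_self_pos {S : Matrix (Fin N) (Fin N) ℝ} (hS : S.PosSemidef)
    {w : Vec N} (hw : Matrix.toEuclideanLin S w ≠ 0) :
    0 < inner ℝ w (Matrix.toEuclideanLin S w) := by
  have hquad : inner ℝ w (Matrix.toEuclideanLin S w) = star w.ofLp ⬝ᵥ S.mulVec w.ofLp :=
    Matrix.inner_toEuclideanCLM S w w
  rw [hquad]
  refine lt_of_le_of_ne (hS.dotProduct_mulVec_nonneg w.ofLp) fun h => hw ?_
  rw [Matrix.toLpLin_apply, (hS.dotProduct_mulVec_zero_iff w.ofLp).1 h.symm, WithLp.toLp_zero]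

theorem hasConsistentTests_measurementLaw (Φ : Matrix (Fin M) (Fin N) ℝ)
    {S T : Matrix (Fin N) (Fin N) ℝ} (hS : S.PosSemidef) (hT : T.PosSemidef) {c : Vec M} {w : Vec N}
    (hw : Matrix.toEuclideanLin Φ.transpose c = w) (hSw : Matrix.toEuclideanLin S w ≠ 0)
    (hTw : Matrix.toEuclideanLin T w = 0) :
    HasConsistentTests (𝓝[>] 0) (fun s => measurementLaw Φ s S)
      (fun s => measurementLaw Φ s T) := by
  have hSpos := inner_toEuclideanLin_self_pos hS hSw
  have hc : c ≠ 0 := by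
    rintro rfl
    exact hSw (by rw [← hw, map_zero, map_zero])
  refine .of_map (f := innerSL ℝ c) (by fun_prop)
    (P' := fun s => gaussianReal 0 ((inner ℝ w (Matrix.toEuclideanLin S w)).toNNReal +
      (s * ‖c‖ ^ 2).toNNReal))
    (Q' := fun s => gaussianReal 0 (s * ‖c‖ ^ 2).toNNReal)
    ?_ ?_ (hasConsistentTests_gaussianReal (Real.toNNReal_pos.2 hSpos).ne'
      (Eventually.of_forall fun s => le_self_add) ?_)
  · filter_upwards [self_mem_nhdsWithin] with s hs
    exact map_inner_measurementLaw Φ (le_of_lt hs) hS c hw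
  · filter_upwards [self_mem_nhdsWithin] with s hs
    rw [map_inner_measurementLaw Φ (le_of_lt hs) hT c hw, hTw, inner_zero_right, Real.toNNReal_zero,
      zero_add]
  · refine tendsto_nhdsWithin_iff.2 ⟨?_, ?_⟩
    · have hcont : Continuous fun s : ℝ => (s * ‖c‖ ^ 2).toNNReal := by fun_prop
      simpa using (hcont.tendsto 0).mono_left nhdsWithin_le_nhds
    · filter_upwards [self_mem_nhdsWithin] with s hs
      exact Real.toNNReal_pos.2 (mul_pos hs (by positivity))

/-! ### The error of a MAP classifier -/

theorem ofReal_mul_measurementLaw_real (q : ℝ) (Φ : Matrix (Fin M) (Fin N) ℝ) {s : ℝ} (hs : 0 < s)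
    (S : Matrix (Fin N) (Fin N) ℝ) (A : Set (Vec M)) :
    ENNReal.ofReal (q * (measurementLaw Φ s S).real A) =
      ∫⁻ y in A, measurementPDF Φ s S y * ENNReal.ofReal q := by
  simp only [measurementPDF]
  rw [lintegral_mul_const _ (Measure.measurable_rnDeriv _ _),
    Measure.setLIntegral_rnDeriv (measurementLaw_absolutelyContinuous Φ hs S),
    mul_comm, ENNReal.ofReal_mul measureReal_nonneg, ofReal_measureReal]

variable {p : Fin L → ℝ} {S : Fin L → Matrix (Fin N) (Fin N) ℝ} {Φ : Matrix (Fin M) (Fin N) ℝ}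

-- Where `c = j` the posterior of `j` dominates that of `i`, so the part of the mass outside `A` can
-- be charged to class `j`.
theorem IsMAP.confusion_le (hp : ∀ i, 0 ≤ p i) {s : ℝ} (hs : 0 < s) {c : Vec M → Fin L}
    (hc : IsMAP p S Φ s c) (i j : Fin L) {A : Set (Vec M)} (hA : MeasurableSet A) :
    p i * (measurementLaw Φ s (S i)).real {y | c y = j} ≤
      p i * (measurementLaw Φ s (S i)).real A + p j * (measurementLaw Φ s (S j)).real Aᶜ := by
  have hj : MeasurableSet {y | c y = j} := hc.1 (measurableSet_singleton j)
  have hnonneg (k : Fin L) (B : Set (Vec M)) : 0 ≤ p k * (measurementLaw Φ s (S k)).real B :=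
    mul_nonneg (hp k) measureReal_nonneg
  rw [← ENNReal.ofReal_le_ofReal_iff (add_nonneg (hnonneg i A) (hnonneg j Aᶜ)),
    ENNReal.ofReal_add (hnonneg i A) (hnonneg j Aᶜ)]
  simp only [ofReal_mul_measurementLaw_real _ Φ hs]
  rw [← lintegral_inter_add_sdiff _ _ hA]
  gcongr ?_ + ?_
  · exact lintegral_mono_set Set.inter_subset_right
  · calc ∫⁻ y in {y | c y = j} \ A, measurementPDF Φ s (S i) y * ENNReal.ofReal (p i)
      _ ≤ ∫⁻ y in {y | c y = j} \ A, measurementPDF Φ s (S j) y * ENNReal.ofReal (p j) := by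
          refine lintegral_mono_ae ?_
          filter_upwards [ae_restrict_of_ae hc.2, ae_restrict_mem (hj.diff hA)] with y hmax hy
          simpa only [show c y = j from hy.1] using hmax i
      _ ≤ ∫⁻ y in Aᶜ, measurementPDF Φ s (S j) y * ENNReal.ofReal (p j) :=
          lintegral_mono_set fun y hy => hy.2

theorem misclassificationProb_le_sum_confusion (hp : ∀ i, 0 ≤ p i) (s : ℝ) (c : Vec M → Fin L) :
    misclassificationProb p S Φ s c ≤ ∑ i, ∑ j ∈ Finset.univ.erase i,
      p i * (measurementLaw Φ s (S i)).real {y | c y = j} := by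
  refine Finset.sum_le_sum fun i _ => ?_
  rw [← Finset.mul_sum]
  refine mul_le_mul_of_nonneg_left ((measureReal_mono (fun y hy => ?_) (measure_ne_top _ _)).trans
    (measureReal_biUnion_finset_le (Finset.univ.erase i) fun j => {y | c y = j})) (hp i)
  exact Set.mem_biUnion (Finset.mem_coe.2 (Finset.mem_erase.2 ⟨hy, Finset.mem_univ _⟩)) rfl

theorem lowNoisePhaseTransition_of_hasConsistentTests (hp : ∀ i, 0 ≤ p i)
    (h : ∀ i j, i ≠ j → HasConsistentTests (𝓝[>] 0)
      (fun s => measurementLaw Φ s (S i)) (fun s => measurementLaw Φ s (S j))) :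
    LowNoisePhaseTransition p S Φ := by
  intro c hc
  have hconf (i j : Fin L) (hij : i ≠ j) :
      Tendsto (fun s => p i * (measurementLaw Φ s (S i)).real {y | c s y = j}) (𝓝[>] 0) (𝓝 0) := by
    obtain ⟨A, hA, hAi, hAj⟩ := h i j hij
    refine squeeze_zero' (Eventually.of_forall fun s => mul_nonneg (hp i) measureReal_nonneg) ?_
      (by simpa using (hAi.const_mul (p i)).add (hAj.const_mul (p j)))
    filter_upwards [self_mem_nhdsWithin] with s hs
    exact (hc s hs).confusion_le hp hs i j (hA s)
  refine squeeze_zero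
    (fun s => Finset.sum_nonneg fun i _ => mul_nonneg (hp i) measureReal_nonneg)
    (fun s => misclassificationProb_le_sum_confusion hp s (c s)) ?_
  simpa using tendsto_finsetSum (Finset.univ : Finset (Fin L)) fun i _ =>
    tendsto_finsetSum (Finset.univ.erase i) fun j hj => hconf i j (Finset.ne_of_mem_erase hj).symm

/-! ### Discriminating subspaces -/

/-- Some vector of `U` is orthogonal to `V` but not to `W`: linear measurements with row space `U`
see a component of `W` on which signals from `V` vanish. -/
def Discriminates {E : Type*} [NormedAddCommGroup E] [InnerProductSpace ℝ E]
    (U V W : Submodule ℝ E) : Prop :=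
  ∃ u ∈ U, u ∈ Vᗮ ∧ u ∉ Wᗮ

section InnerProductSpace

variable {E : Type*} [NormedAddCommGroup E] [InnerProductSpace ℝ E]

theorem Discriminates.mono {U U' V W : Submodule ℝ E} (hU : U ≤ U') (h : Discriminates U V W) :
    Discriminates U' V W :=
  let ⟨u, hu, hV, hW⟩ := h
  ⟨u, hU hu, hV, hW⟩

theorem discriminates_span_of_linearIndependent_starProjection {ι : Type*} [Fintype ι] {w : ι → E}
    {V W : Submodule ℝ E} [FiniteDimensional ℝ V] [W.HasOrthogonalProjection]
    (hV : Module.finrank ℝ V < Fintype.card ι)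
    (hw : LinearIndependent ℝ fun a => (V.starProjection (w a), W.starProjection (w a))) :
    Discriminates (Submodule.span ℝ (Set.range w)) V W := by
  have hdep : ¬LinearIndependent ℝ fun a => V.orthogonalProjectionOnto (w a) := fun h =>
    h.fintype_card_le_finrank.not_gt hV
  obtain ⟨c, hc, a, ha⟩ := Fintype.not_linearIndependent_iff.1 hdep
  have hcV : V.starProjection (∑ a, c a • w a) = 0 := by
    have hproj : V.orthogonalProjectionOnto (∑ a, c a • w a) = 0 := by simpa using hc
    rw [Submodule.starProjection_apply, hproj, Submodule.coe_zero]
  refine ⟨∑ a, c a • w a, Submodule.sum_mem _ fun a _ => Submodule.smul_mem _ _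
    (Submodule.subset_span ⟨a, rfl⟩), (V.starProjection_apply_eq_zero_iff).1 hcV, fun hcW => ha ?_⟩
  rw [← W.starProjection_apply_eq_zero_iff] at hcW
  refine Fintype.linearIndependent_iff.1 hw c (Prod.ext ?_ ?_) a
  · simpa [Prod.fst_sum] using hcV
  · simpa [Prod.snd_sum] using hcW

end InnerProductSpace

theorem nullSpace_eq_orthogonal_image {S : Matrix (Fin N) (Fin N) ℝ} (hS : S.IsHermitian) :
    nullSpace S = (image S)ᗮ :=
  (Matrix.isSymmetric_toEuclideanLin_iff.2 hS).orthogonal_range.symm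

theorem range_toEuclideanLin_transpose (Φ : Matrix (Fin M) (Fin N) ℝ) :
    LinearMap.range (Matrix.toEuclideanLin Φ.transpose) =
      Submodule.span ℝ (Set.range fun m => (WithLp.toLp 2 (Φ m) : Vec N)) := by
  have happly (c : Vec M) :
      Matrix.toEuclideanLin Φ.transpose c = ∑ m, c m • (WithLp.toLp 2 (Φ m) : Vec N) := by
    ext j
    simp [Matrix.toLpLin_apply, Matrix.mulVec, dotProduct, mul_comm]
  ext v
  rw [LinearMap.mem_range, Submodule.mem_span_range_iff_exists_fun]
  exact ⟨fun ⟨c, hc⟩ => ⟨c, (happly c).symm.trans hc⟩,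
    fun ⟨c, hc⟩ => ⟨WithLp.toLp 2 c, (happly _).trans hc⟩⟩

theorem hasConsistentTests_of_discriminates {S T : Matrix (Fin N) (Fin N) ℝ} (hS : S.PosSemidef)
    (hT : T.PosSemidef) (h : Discriminates
      (Submodule.span ℝ (Set.range fun m => (WithLp.toLp 2 (Φ m) : Vec N))) (image T) (image S)) :
    HasConsistentTests (𝓝[>] 0) (fun s => measurementLaw Φ s S)
      (fun s => measurementLaw Φ s T) := by
  obtain ⟨w, hw, hTw, hSw⟩ := h
  rw [← range_toEuclideanLin_transpose] at hw
  obtain ⟨c, hc⟩ := hw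
  rw [← nullSpace_eq_orthogonal_image hT.1, LinearMap.mem_ker] at hTw
  rw [← nullSpace_eq_orthogonal_image hS.1, LinearMap.mem_ker] at hSw
  exact hasConsistentTests_measurementLaw Φ hS hT hc hSw hTw

theorem lowNoisePhaseTransition_of_discriminates (hp : ∀ i, 0 ≤ p i) (hS : ∀ i, (S i).PosSemidef)
    {U : Submodule ℝ (Vec N)}
    (hU : U = Submodule.span ℝ (Set.range fun m => (WithLp.toLp 2 (Φ m) : Vec N)))
    (h : ∀ i j, i ≠ j → Discriminates U (image (S i)) (image (S j)) ∨
      Discriminates U (image (S j)) (image (S i))) :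
    LowNoisePhaseTransition p S Φ := by
  subst hU
  refine lowNoisePhaseTransition_of_hasConsistentTests hp fun i j hij => ?_
  rcases h i j hij with h | h
  · exact (hasConsistentTests_of_discriminates (hS j) (hS i) h).symm
  · exact hasConsistentTests_of_discriminates (hS i) (hS j) h

/-! ### Gaussian vectors in general position -/

section Gaussian

variable {E : Type*} [NormedAddCommGroup E] [InnerProductSpace ℝ E] [FiniteDimensional ℝ E]

theorem isOpen_setOf_disjoint_ker {F : Type*} [NormedAddCommGroup F] [NormedSpace ℝ F]
    (U : Submodule ℝ E) : IsOpen {T : E →L[ℝ] F | Disjoint U (LinearMap.ker T.toLinearMap)} := by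
  have hset : {T : E →L[ℝ] F | Disjoint U (LinearMap.ker T.toLinearMap)} =
      (fun T : E →L[ℝ] F => T ∘L U.subtypeL) ⁻¹' {T | Function.Injective T} := by
    ext T
    exact (LinearMap.injective_domRestrict_iff (f := T.toLinearMap) (S := U)).symm
  rw [hset]
  exact ContinuousLinearMap.isOpen_injective.preimage (by fun_prop)

theorem orthogonal_span_range_eq_ker {ι : Type*} (g : ι → E) :
    (Submodule.span ℝ (Set.range g))ᗮ =
      LinearMap.ker (ContinuousLinearMap.pi fun i => innerSL ℝ (g i)).toLinearMap := by
  ext x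
  rw [← Submodule.span_singleton_le_iff_mem, ← Submodule.le_orthogonal_iff_le_orthogonal,
    Submodule.span_le, Set.range_subset_iff]
  simp [Submodule.mem_orthogonal_singleton_iff_inner_left, funext_iff]

theorem isOpen_setOf_disjoint_orthogonal_span_range {ι : Type*} [Finite ι] (U : Submodule ℝ E) :
    IsOpen {g : ι → E | Disjoint U (Submodule.span ℝ (Set.range g))ᗮ} := by
  have := Fintype.ofFinite ι
  simp only [orthogonal_span_range_eq_ker]
  refine (isOpen_setOf_disjoint_ker U).preimage (continuous_clm_apply.2 fun x => ?_)
  exact continuous_pi fun i => (continuous_apply i).inner continuous_const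

theorem ae_pi_mem_of_ae_ae_cons_mem {α : Type*} [MeasurableSpace α] {μ : Measure α} [SigmaFinite μ]
    {n : ℕ} {A : Set (Fin (n + 1) → α)} (hA : MeasurableSet A)
    (h : ∀ᵐ x ∂μ, ∀ᵐ g ∂Measure.pi (fun _ : Fin n => μ), (Fin.cons x g : Fin (n + 1) → α) ∈ A) :
    ∀ᵐ g ∂Measure.pi (fun _ : Fin (n + 1) => μ), g ∈ A := by
  have hmp := (measurePreserving_piFinSuccAbove (fun _ : Fin (n + 1) => μ) 0).symm
  rw [← hmp.map_eq]
  refine (ae_map_iff hmp.measurable.aemeasurable hA).2 ?_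
  refine (Measure.ae_prod_mem_iff_ae_ae_mem (hmp.measurable hA)).2 ?_
  filter_upwards [h] with x hx
  filter_upwards [hx] with g hg
  simpa [Fin.insertNthEquiv_zero, Fin.consEquiv] using hg

variable [MeasurableSpace E] [BorelSpace E]

theorem ae_notMem_stdGaussian {U : Submodule ℝ E} (hU : U ≠ ⊤) : ∀ᵐ g ∂stdGaussian E, g ∉ U :=
  (stdGaussian_absolutelyContinuous E).ae_le
    (measure_eq_zero_iff_ae_notMem.1 (Measure.addHaar_submodule volume U hU))

theorem ae_disjoint_orthogonal_span_range {n : ℕ} {U : Submodule ℝ E}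
    (hU : Module.finrank ℝ U ≤ n) :
    ∀ᵐ g ∂Measure.pi (fun _ : Fin n => stdGaussian E),
      Disjoint U (Submodule.span ℝ (Set.range g))ᗮ := by
  induction n generalizing U with
  | zero =>
    rw [Submodule.finrank_eq_zero.1 (Nat.le_zero.1 hU)]
    exact Eventually.of_forall fun g => disjoint_bot_left
  | succ n ih =>
    rcases eq_or_ne U ⊥ with rfl | hU0
    · exact Eventually.of_forall fun g => disjoint_bot_left
    refine ae_pi_mem_of_ae_ae_cons_mem
      (isOpen_setOf_disjoint_orthogonal_span_range U).measurableSet ?_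
    filter_upwards [ae_notMem_stdGaussian (mt U.orthogonal_eq_top_iff.1 hU0)] with x hx
    have hlt : U ⊓ (ℝ ∙ x)ᗮ < U := by
      rwa [inf_lt_left, Submodule.le_orthogonal_iff_le_orthogonal,
        Submodule.span_singleton_le_iff_mem]
    filter_upwards [ih (Nat.le_of_lt_succ
      ((Submodule.finrank_lt_finrank_of_lt hlt).trans_le hU))] with g hg
    change Disjoint U (Submodule.span ℝ (Set.range (Fin.cons x g : Fin (n + 1) → E)))ᗮ
    rwa [Fin.range_cons, Submodule.span_insert, ← Submodule.inf_orthogonal, ← disjoint_assoc]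

end Gaussian

/-! ### Uniformly distributed subspaces -/

theorem Grassmannian.isInducing_proj :
    IsInducing (Grassmannian.proj : Grassmannian N r → Vec N →L[ℝ] Vec N) :=
  ⟨rfl⟩

instance : SecondCountableTopology (Grassmannian N r) :=
  Grassmannian.isInducing_proj.secondCountableTopology

theorem Grassmannian.ker_proj (W : Grassmannian N r) :
    LinearMap.ker (W.proj : Vec N →ₗ[ℝ] Vec N) = W.1ᗮ :=
  W.1.ker_starProjection

theorem Grassmannian.proj_eq_zero_iff (W : Grassmannian N r) {v : Vec N} :
    W.proj v = 0 ↔ v ∈ W.1ᗮ :=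
  W.1.starProjection_apply_eq_zero_iff

theorem Grassmannian.continuous_proj_apply {X : Type*} [TopologicalSpace X]
    {W : X → Grassmannian N r} {v : X → Vec N} (hW : Continuous W) (hv : Continuous v) :
    Continuous fun x => (W x).proj (v x) :=
  (Grassmannian.isInducing_proj.continuous.comp hW).clm_apply hv

theorem ae_uniformGrassmannian {P : Grassmannian N r → Prop} (hP : MeasurableSet {W | P W})
    (h : ∀ᵐ g ∂Measure.pi (fun _ : Fin r => stdGaussian (Vec N)),
      ∀ hg : LinearIndependent ℝ g, P (Frame.span ⟨g, hg⟩)) :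
    ∀ᵐ W ∂uniformGrassmannian N r, P W := by
  refine (ae_map_iff Frame.measurable_span.aemeasurable hP).2 ?_
  refine (Frame.measurableEmbedding_val.comap_apply _ _).trans (measure_mono_null ?_ h)
  rintro _ ⟨v, hv, rfl⟩ h0
  exact hv (h0 v.2)

theorem ae_disjoint_orthogonal {U : Submodule ℝ (Vec N)} (hU : Module.finrank ℝ U ≤ r) :
    ∀ᵐ W ∂uniformGrassmannian N r, Disjoint U W.1ᗮ := by
  have hmeas : MeasurableSet {W : Grassmannian N r | Disjoint U W.1ᗮ} := by
    simp only [← Grassmannian.ker_proj]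
    exact ((isOpen_setOf_disjoint_ker U).preimage
      Grassmannian.isInducing_proj.continuous).measurableSet
  refine ae_uniformGrassmannian hmeas ?_
  filter_upwards [ae_disjoint_orthogonal_span_range hU] with g hg _ using hg

theorem ae_proj_ne_zero (hr : 1 ≤ r) {v : Vec N} (hv : v ≠ 0) :
    ∀ᵐ W ∂uniformGrassmannian N r, W.proj v ≠ 0 := by
  filter_upwards [ae_disjoint_orthogonal ((finrank_span_singleton (K := ℝ) hv).trans_le hr)]
    with W hW h
  exact hv (Submodule.disjoint_def.1 hW v (Submodule.mem_span_singleton_self v)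
    (W.proj_eq_zero_iff.1 h))

theorem exists_le_finrank_eq {K E : Type*} [DivisionRing K] [AddCommGroup E] [Module K E]
    {V : Submodule K E} {n : ℕ} (hn : n ≤ Module.finrank K V) :
    ∃ U ≤ V, Module.finrank K U = n := by
  obtain ⟨w, hw⟩ := exists_linearIndependent_of_le_finrank hn
  refine ⟨(Submodule.span K (Set.range w)).map V.subtype, Submodule.map_subtype_le _ _, ?_⟩
  rw [Submodule.finrank_map_subtype_eq, finrank_span_eq_card hw, Fintype.card_fin]

theorem ae_notMem_of_ne_zero (hrN : r < N) {v : Vec N} (hv : v ≠ 0) :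
    ∀ᵐ W ∂uniformGrassmannian N r, v ∉ W.1 := by
  have hdim : Module.finrank ℝ (ℝ ∙ v)ᗮ + 1 = N := by
    have := Submodule.finrank_add_finrank_orthogonal (ℝ ∙ v)
    rw [finrank_span_singleton hv, finrank_euclideanSpace_fin] at this
    omega
  obtain ⟨U, hUv, hU⟩ := exists_le_finrank_eq (K := ℝ) (V := (ℝ ∙ v)ᗮ) (n := r) (by omega)
  filter_upwards [ae_disjoint_orthogonal hU.le] with W hW hvW
  have hWv : W.1ᗮ ≤ (ℝ ∙ v)ᗮ :=
    Submodule.orthogonal_le ((Submodule.span_singleton_le_iff_mem v W.1).2 hvW)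
  have hle := Submodule.finrank_mono (sup_le hUv hWv)
  have hsum := Submodule.finrank_sup_add_finrank_inf_eq U W.1ᗮ
  rw [hW.eq_bot, finrank_bot, hU] at hsum
  have hWdim := Submodule.finrank_add_finrank_orthogonal W.1
  rw [W.2, finrank_euclideanSpace_fin] at hWdim
  omega

section LinearIndependent

variable {ι : Type*} [Fintype ι] {w : ι → Vec N}

theorem ae_linearIndependent_proj (hw : LinearIndependent ℝ w)
    (hι : Fintype.card ι ≤ r) :
    ∀ᵐ W ∂uniformGrassmannian N r, LinearIndependent ℝ fun a => W.proj (w a) := by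
  filter_upwards [ae_disjoint_orthogonal ((finrank_span_eq_card hw).trans_le hι)] with W hW
  exact hw.map (f := (W.proj : Vec N →ₗ[ℝ] Vec N)) (W.ker_proj ▸ hW)

theorem ae_linearIndependent_proj_prod (hw : LinearIndependent ℝ w)
    (hι : Fintype.card ι ≤ r + 1) {V : Grassmannian N r} {a : ι} (hV : V.proj (w a) ≠ 0) :
    ∀ᵐ W ∂uniformGrassmannian N r,
      LinearIndependent ℝ fun a => (V.proj (w a), W.proj (w a)) := by
  have hlt : Submodule.span ℝ (Set.range w) ⊓ V.1ᗮ < Submodule.span ℝ (Set.range w) :=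
    inf_lt_left.2 fun h => hV (V.proj_eq_zero_iff.2 (h (Submodule.subset_span ⟨a, rfl⟩)))
  have hrank := (Submodule.finrank_lt_finrank_of_lt hlt).trans_le
    ((finrank_span_eq_card hw).trans_le hι)
  filter_upwards [ae_disjoint_orthogonal (Nat.le_of_lt_succ hrank)] with W hW
  refine hw.map (f := (V.proj : Vec N →ₗ[ℝ] Vec N).prod (W.proj : Vec N →ₗ[ℝ] Vec N)) ?_
  rw [LinearMap.ker_prod, V.ker_proj, W.ker_proj]
  exact disjoint_assoc.1 hW

end LinearIndependent

/-! ### Random subspaces with vectors in general position -/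

section Random

variable {Ω : Type*} [MeasurableSpace Ω] {μ : Measure Ω}

theorem ae_mem_of_indepFun [IsFiniteMeasure μ] {E F : Type*} [MeasurableSpace E]
    [MeasurableSpace F] {ν : Measure F} {X : Ω → E} {T : Ω → F} (hX : Measurable X)
    (hT : Measurable T) (hTν : μ.map T ≪ ν) (hind : IndepFun X T μ) {A : Set (E × F)}
    (hA : MeasurableSet A) (h : ∀ᵐ ω ∂μ, ∀ᵐ t ∂ν, (X ω, t) ∈ A) : ∀ᵐ ω ∂μ, (X ω, T ω) ∈ A := by
  have hprod := (indepFun_iff_map_prod_eq_prod_map_map hX.aemeasurable hT.aemeasurable).1 hind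
  refine ae_of_ae_map (f := fun ω => (X ω, T ω)) (p := (· ∈ A)) (hX.prodMk hT).aemeasurable ?_
  rw [hprod, Measure.ae_prod_mem_iff_ae_ae_mem hA, ae_map_iff hX.aemeasurable]
  · filter_upwards [h] with ω hω using hTν.ae_le hω
  · exact measurable_measure_prodMk_left hA.compl (measurableSet_singleton 0)

variable {ι κ : Type*}

/-- Random subspaces `R i` of `ℝᴺ` with laws absolutely continuous with respect to the uniform one,
and nonzero random vectors `B i · k` orthogonal to them, independent for different `i`: the
candidates for the rows of a one-vs-all matrix. -/
structure IsOneVsAllSystem (μ : Measure Ω) (R : ι → Ω → Grassmannian N r)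
    (B : ι → Ω → κ → Vec N) : Prop where
  measurable_subspace : ∀ i, Measurable (R i)
  absolutelyContinuous : ∀ i, μ.map (R i) ≪ uniformGrassmannian N r
  measurable_vectors : ∀ i, Measurable (B i)
  iIndepFun : iIndepFun (fun i ω => (R i ω, B i ω)) μ
  ae_ne_zero : ∀ i k, ∀ᵐ ω ∂μ, B i ω k ≠ 0
  mem_orthogonal : ∀ i ω k, B i ω k ∈ (R i ω).1ᗮ

namespace IsOneVsAllSystem

variable {R : ι → Ω → Grassmannian N r} {B : ι → Ω → κ → Vec N}

theorem ae_mem_of_notMem (h : IsOneVsAllSystem μ R B) {s : Finset ι} {j : ι}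
    (hj : j ∉ s) {E : Type*} [MeasurableSpace E] {φ : (s → Grassmannian N r × (κ → Vec N)) → E}
    (hφ : Measurable φ) {A : Set (E × Grassmannian N r)} (hA : MeasurableSet A)
    (hφA : ∀ᵐ ω ∂μ, ∀ᵐ W ∂uniformGrassmannian N r, (φ fun i => (R i ω, B i ω), W) ∈ A) :
    ∀ᵐ ω ∂μ, (φ fun i => (R i ω, B i ω), R j ω) ∈ A := by
  have := h.iIndepFun.isProbabilityMeasure
  have hmeas (i : ι) : Measurable fun ω => (R i ω, B i ω) :=
    (h.measurable_subspace i).prodMk (h.measurable_vectors i)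
  have hind := h.iIndepFun.indepFun_finset s {j} (Finset.disjoint_singleton_right.2 hj) hmeas
  refine ae_mem_of_indepFun (hφ.comp (measurable_pi_lambda _ fun i => hmeas i))
    (h.measurable_subspace j) (h.absolutelyContinuous j) ?_ hA hφA
  exact hind.comp hφ (ψ := fun z => (z ⟨j, Finset.mem_singleton_self j⟩).1) (by fun_prop)

theorem ae_proj_ne_zero (h : IsOneVsAllSystem μ R B) (hr : 1 ≤ r) {i j : ι}
    (hij : i ≠ j) (k : κ) : ∀ᵐ ω ∂μ, (R j ω).proj (B i ω k) ≠ 0 := by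
  have hA : MeasurableSet {z : Vec N × Grassmannian N r | z.2.proj z.1 ≠ 0} :=
    (isOpen_ne_fun (Grassmannian.continuous_proj_apply continuous_snd continuous_fst)
      continuous_const).measurableSet
  exact h.ae_mem_of_notMem (s := {i}) (by simpa using hij.symm)
    (φ := fun z => (z ⟨i, Finset.mem_singleton_self i⟩).2 k) (by fun_prop) hA
    ((h.ae_ne_zero i k).mono fun ω hω => SubspaceClassification.ae_proj_ne_zero hr hω)

theorem ae_linearIndependent_proj (h : IsOneVsAllSystem μ R B) {m : ℕ}
    (hm : m ≤ r) {σ : Fin m → ι} {k : Fin m → κ}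
    (hB : ∀ᵐ ω ∂μ, LinearIndependent ℝ fun a => B (σ a) ω (k a)) {j : ι} (hj : j ∉ Set.range σ) :
    ∀ᵐ ω ∂μ, LinearIndependent ℝ fun a => (R j ω).proj (B (σ a) ω (k a)) := by
  classical
  have hA : MeasurableSet {z : (Fin m → Vec N) × Grassmannian N r |
      LinearIndependent ℝ fun a => z.2.proj (z.1 a)} :=
    (isOpen_setOfPred_linearIndependent.preimage (continuous_pi fun a =>
      Grassmannian.continuous_proj_apply continuous_snd (by fun_prop))).measurableSet
  have hmem (a : Fin m) : σ a ∈ Finset.univ.image σ := Finset.mem_image_of_mem σ (Finset.mem_univ a)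
  exact h.ae_mem_of_notMem (s := Finset.univ.image σ) (by simpa using hj)
    (φ := fun z a => (z ⟨σ a, hmem a⟩).2 (k a)) (by fun_prop) hA
    (hB.mono fun ω hω => SubspaceClassification.ae_linearIndependent_proj hω (by simpa using hm))

theorem ae_linearIndependent (h : IsOneVsAllSystem μ R B) {m : ℕ}
    (hm : m ≤ r + 1) {σ : Fin m → ι} (hσ : Function.Injective σ) (k : Fin m → κ) :
    ∀ᵐ ω ∂μ, LinearIndependent ℝ fun a => B (σ a) ω (k a) := by
  induction m with
  | zero => exact Eventually.of_forall fun ω => linearIndependent_empty_type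
  | succ m ih =>
    have hinit := ih (by omega) (hσ.comp (Fin.castSucc_injective m)) (k ∘ Fin.castSucc)
    have hlast : σ (Fin.last m) ∉ Set.range (σ ∘ Fin.castSucc) := fun ⟨a, ha⟩ =>
      (Fin.castSucc_lt_last a).ne (hσ ha)
    filter_upwards [hinit, h.ae_linearIndependent_proj (by omega) hinit hlast,
      h.ae_ne_zero (σ (Fin.last m)) (k (Fin.last m))] with ω hω hproj hne
    have hdisj := Submodule.range_ker_disjoint (f := (R (σ (Fin.last m)) ω).proj.toLinearMap) hproj
    rw [Grassmannian.ker_proj] at hdisj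
    have hsnoc : (fun a => B (σ a) ω (k a)) = Fin.snoc
        (fun a : Fin m => B (σ a.castSucc) ω (k a.castSucc))
        (B (σ (Fin.last m)) ω (k (Fin.last m))) := by
      ext1 a
      refine Fin.lastCases ?_ (fun a => ?_) a <;> simp
    rw [hsnoc, linearIndependent_finSnoc]
    exact ⟨hω, fun hspan => hne (Submodule.disjoint_def.1 hdisj _ hspan (h.mem_orthogonal _ ω _))⟩

theorem ae_discriminates_of_notMem_range (h : IsOneVsAllSystem μ R B)
    (hr : 1 ≤ r) {σ : Fin (r + 1) → ι} (hσ : Function.Injective σ) (k : Fin (r + 1) → κ) {i j : ι}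
    (hij : i ≠ j) (hi : i ∉ Set.range σ) (hj : j ∉ Set.range σ) :
    ∀ᵐ ω ∂μ, Discriminates (Submodule.span ℝ (Set.range fun a => B (σ a) ω (k a)))
      (R i ω).1 (R j ω).1 := by
  classical
  have hA : MeasurableSet {z : ((Fin (r + 1) → Vec N) × Grassmannian N r) × Grassmannian N r |
      LinearIndependent ℝ fun a => (z.1.2.proj (z.1.1 a), z.2.proj (z.1.1 a))} :=
    (isOpen_setOfPred_linearIndependent.preimage (continuous_pi fun a =>
      (Grassmannian.continuous_proj_apply (by fun_prop) (by fun_prop)).prodMk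
        (Grassmannian.continuous_proj_apply (by fun_prop) (by fun_prop)))).measurableSet
  have hmem (a : Fin (r + 1)) : σ a ∈ insert i (Finset.univ.image σ) :=
    Finset.mem_insert_of_mem (Finset.mem_image_of_mem σ (Finset.mem_univ a))
  have hrows := h.ae_linearIndependent le_rfl hσ k
  have hproj := h.ae_proj_ne_zero hr (fun h0 => hi ⟨0, h0⟩) (k 0)
  have hprod := h.ae_mem_of_notMem (s := insert i (Finset.univ.image σ)) (j := j)
    (by simpa [hij.symm] using hj)
    (φ := fun z => (fun a => (z ⟨σ a, hmem a⟩).2 (k a), (z ⟨i, Finset.mem_insert_self _ _⟩).1))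
    (by fun_prop) hA ((hrows.and hproj).mono fun ω hω =>
      ae_linearIndependent_proj_prod hω.1 (by simp) hω.2)
  filter_upwards [hprod] with ω hω
  exact discriminates_span_of_linearIndependent_starProjection (by simp [(R i ω).2]) hω

theorem ae_discriminates [Fintype ι] (h : IsOneVsAllSystem μ R B) (hr : 1 ≤ r)
    {m : ℕ} (hm : min (Fintype.card ι - 1) (r + 1) ≤ m) {σ : Fin m → ι}
    (hσ : Function.Injective σ) (k : Fin m → κ) {i j : ι} (hij : i ≠ j) :
    ∀ᵐ ω ∂μ,
      Discriminates (Submodule.span ℝ (Set.range fun a => B (σ a) ω (k a))) (R i ω).1 (R j ω).1 ∨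
        Discriminates (Submodule.span ℝ (Set.range fun a => B (σ a) ω (k a)))
          (R j ω).1 (R i ω).1 := by
  classical
  have hrow {i j : ι} (hij : i ≠ j) (hi : i ∈ Set.range σ) : ∀ᵐ ω ∂μ,
      Discriminates (Submodule.span ℝ (Set.range fun a => B (σ a) ω (k a)))
        (R i ω).1 (R j ω).1 := by
    obtain ⟨a, rfl⟩ := hi
    filter_upwards [h.ae_proj_ne_zero hr hij (k a)] with ω hω
    exact ⟨_, Submodule.subset_span ⟨a, rfl⟩, h.mem_orthogonal _ ω _,
      mt (R j ω).proj_eq_zero_iff.2 hω⟩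
  by_cases hi : i ∈ Set.range σ
  · exact (hrow hij hi).mono fun ω => Or.inl
  by_cases hj : j ∈ Set.range σ
  · exact (hrow hij.symm hj).mono fun ω => Or.inr
  have hcard : m + 2 ≤ Fintype.card ι := by
    have hinsert : (insert i (insert j (Finset.univ.image σ))).card = m + 2 := by
      rw [Finset.card_insert_of_notMem (by simpa [hij] using hi),
        Finset.card_insert_of_notMem (by simpa using hj),
        Finset.card_image_of_injective _ hσ, Finset.card_fin]
    exact hinsert ▸ Finset.card_le_univ _
  have hrm : r + 1 ≤ m := by omega
  filter_upwards [h.ae_discriminates_of_notMem_range hr (hσ.comp (Fin.castLE_injective hrm))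
    (k ∘ Fin.castLE hrm) hij (fun ⟨a, ha⟩ => hi ⟨_, ha⟩) (fun ⟨a, ha⟩ => hj ⟨_, ha⟩)] with ω hω
  refine Or.inl (hω.mono (Submodule.span_mono ?_))
  rintro _ ⟨a, rfl⟩
  exact ⟨Fin.castLE hrm a, rfl⟩

end IsOneVsAllSystem

variable {S : Fin L → Ω → Matrix (Fin N) (Fin N) ℝ}
  {R : Fin L → Ω → Grassmannian N r}

theorem IsOneVsAllSystem.ae_lowNoisePhaseTransition {d : ℕ} {B : Fin L → Ω → Fin d → Vec N}
    (h : IsOneVsAllSystem μ R B) (hr : 1 ≤ r) (hp : ∀ i, 0 ≤ p i)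
    (hS : ∀ i ω, (S i ω).PosSemidef) (hRS : ∀ i ω, (R i ω).1 = image (S i ω))
    (hM : min (L - 1) (r + 1) ≤ M) (hML : M ≤ L) :
    ∀ᵐ ω ∂μ, ∀ (π : Equiv.Perm (Fin L)) (k : Fin M → Fin d),
      LowNoisePhaseTransition p (fun i => S i ω) (oneVsAllMatrix hML (fun i => B i ω) π k) := by
  have hpairs (π : Equiv.Perm (Fin L)) (k : Fin M → Fin d) (i j : Fin L) (hij : i ≠ j) :=
    h.ae_discriminates hr (by simpa using hM) (π.injective.comp (Fin.castLE_injective hML)) k hij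
  simp only [← ae_all_iff] at hpairs
  filter_upwards [hpairs] with ω hω π k
  refine lowNoisePhaseTransition_of_discriminates hp (fun i => hS i ω) rfl fun i j hij => ?_
  simp only [← hRS]
  exact hω π k i j hij

theorem isOneVsAllSystem_sub_proj (hrN : r < N) {ι : Type*} {R : ι → Ω → Grassmannian N r}
    (hR : ∀ i, Measurable (R i)) (hRac : ∀ i, μ.map (R i) ≪ uniformGrassmannian N r)
    (hRind : iIndepFun R μ) {v : Vec N} (hv : v ≠ 0) :
    IsOneVsAllSystem μ R fun i ω (_ : Fin 1) => v - (R i ω).proj v := by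
  have hmeas : Measurable fun W : Grassmannian N r => fun _ : Fin 1 => v - W.proj v :=
    measurable_pi_lambda _ fun _ => (continuous_const.sub
      (Grassmannian.continuous_proj_apply continuous_id continuous_const)).measurable
  refine ⟨hR, hRac, fun i => hmeas.comp (hR i),
    hRind.comp (fun _ W => (W, fun _ => v - W.proj v)) fun _ => measurable_id.prodMk hmeas,
    fun i _ => ?_, fun i ω _ => (R i ω).1.sub_starProjection_mem_orthogonal v⟩
  filter_upwards [ae_of_ae_map (hR i).aemeasurable ((hRac i).ae_le (ae_notMem_of_ne_zero hrN hv))]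
    with ω hω h0
  exact hω (Submodule.starProjection_eq_self_iff.1 (sub_eq_zero.1 h0).symm)

end Random

end SubspaceClassification

open SubspaceClassification in
theorem proposition5_general {Ω : Type*} [MeasurableSpace Ω] (μ : Measure Ω)
    {N L M r : ℕ} (hr : 1 ≤ r) (hrN : r < N) (hM : min (L - 1) (r + 1) ≤ M) (hML : M ≤ L)
    (p : Fin L → ℝ) (hp : ∀ i, 0 ≤ p i)
    (S : Fin L → Ω → Matrix (Fin N) (Fin N) ℝ) (hS : ∀ i ω, (S i ω).PosSemidef)
    (R : Fin L → Ω → Grassmannian N r) (hRS : ∀ i ω, (R i ω).1 = image (S i ω))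
    (hR : ∀ i, Measurable (R i)) (hRac : ∀ i, μ.map (R i) ≪ uniformGrassmannian N r)
    (hRind : iIndepFun R μ) :
    (∀ᵐ ω ∂μ, ∃ Φ : Matrix (Fin M) (Fin N) ℝ, LowNoisePhaseTransition p (fun i => S i ω) Φ) ∧
    (∀ {d : ℕ} (B : Fin L → Ω → Fin d → Vec N), (∀ i, Measurable (B i)) →
      (∀ i ω k, B i ω k ∈ nullSpace (S i ω)) → (∀ i k, ∀ᵐ ω ∂μ, B i ω k ≠ 0) →
      iIndepFun (fun i ω => (R i ω, B i ω)) μ →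
      ∀ᵐ ω ∂μ, ∀ (π : Equiv.Perm (Fin L)) (k : Fin M → Fin d),
        LowNoisePhaseTransition p (fun i => S i ω) (oneVsAllMatrix hML (fun i => B i ω) π k)) := by
  refine ⟨?_, fun B hB hnull hne hind => ?_⟩
  · have : Nonempty (Fin N) := ⟨⟨0, by omega⟩⟩
    obtain ⟨v, hv⟩ := exists_ne (0 : Vec N)
    filter_upwards [(isOneVsAllSystem_sub_proj hrN hR hRac hRind hv).ae_lowNoisePhaseTransition
      hr hp hS hRS hM hML] with ω hω
    exact ⟨_, hω 1 fun _ => 0⟩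
  · have hsys : IsOneVsAllSystem μ R B :=
      ⟨hR, hRac, hB, hind, hne, fun i ω k => by
        rw [hRS, ← nullSpace_eq_orthogonal_image (hS i ω).1]
        exact hnull i ω k⟩
    exact hsys.ae_lowNoisePhaseTransition hr hp hS hRS hM hML

open SubspaceClassification in
theorem proposition5 {Ω : Type*} [MeasurableSpace Ω] (μ : Measure Ω) [IsProbabilityMeasure μ]
    {N L r : ℕ} (hr : 1 ≤ r) (hrN : r < N)
    -- the prior probabilities of the classes
    (p : Fin L → ℝ) (hp : p ∈ stdSimplex ℝ (Fin L))
    -- the (random) class covariance matrices and their images, which are `r`-dimensional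
    (S : Fin L → Ω → Matrix (Fin N) (Fin N) ℝ) (hS : ∀ i ω, (S i ω).PosSemidef)
    (R : Fin L → Ω → Grassmannian N r) (hRS : ∀ i ω, (R i ω).1 = image (S i ω))
    -- the images are independent and have densities on the Grassmann manifold
    (hR : ∀ i, Measurable (R i)) (hRpdf : ∀ i, HasPDF (R i) μ (uniformGrassmannian N r))
    (hRind : iIndepFun R μ) :
    -- `min {L - 1, r + 1}` designed measurements suffice, with probability one
    (∀ᵐ ω ∂μ, ∃ Φ : Matrix (Fin (min (L - 1) (r + 1))) (Fin N) ℝ,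
      LowNoisePhaseTransition p (fun i => S i ω) Φ) ∧
    -- for bases `B i` of the null spaces, chosen independently for the different classes, every
    -- one-vs-all matrix built from them is such a design, with probability one
    (∀ B : Fin L → Ω → Fin (N - r) → Vec N, (∀ i, Measurable (B i)) →
      (∀ i ω, LinearIndependent ℝ (B i ω) ∧
        Submodule.span ℝ (Set.range (B i ω)) = nullSpace (S i ω)) →
      iIndepFun (fun i ω => (R i ω, B i ω)) μ →
      ∀ᵐ ω ∂μ, ∀ (π : Equiv.Perm (Fin L)) (k : Fin (min (L - 1) (r + 1)) → Fin (N - r)),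
        LowNoisePhaseTransition p (fun i => S i ω)
          (oneVsAllMatrix ((min_le_left _ _).trans (Nat.sub_le L 1)) (fun i => B i ω) π k)) := by
  obtain ⟨hdesign, hrows⟩ := proposition5_general μ hr hrN le_rfl ((min_le_left _ _).trans
    (Nat.sub_le L 1)) p hp.1 S hS R hRS hR (fun i => (hRpdf i).absolutelyContinuous) hRind
  exact ⟨hdesign, fun B hB hbasis => hrows B hB
    (fun i ω k => (hbasis i ω).2 ▸ Submodule.subset_span ⟨k, rfl⟩)
    fun i k => Eventually.of_forall fun ω => (hbasis i ω).1.ne_zero k⟩
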